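/- For a bounded sequence $\alpha=(\alpha_n)_{n\ge 0}$ of positive numbers let $W_\alpha$ be the bounded operator on the complex Hilbert space $\ell^2$ with $W_\alpha e_n=\alpha_n e_{n+1}$ for all $n\ge 0$, where $(e_n)_{n\ge0}$ is the standard basis. A bounded operator on a complex Hilbert space is subnormal if it is unitarily equivalent to the restriction of a normal operator to a closed invariant subspace. The shift $W_\alpha$ is called moment infinitely divisible if, for every real $t>0$, the weighted shift with weights $(\alpha_n^t)_{n\ge 0}$ is subnormal. (i) For every integer $j\ge 1$, the Agler shift $A_j$, with weights $\sqrt{\frac{n+1}{n+j}}$, $n\ge 0$, is moment infinitely divisible. (ii) Let $a,b,c,d>0$ be real with $ad>bc$, and let $S(a,b,c,d)$ be the weighted shift with weights $\alpha_n=\sqrt{\frac{an+b}{cn+d}}$, $n\ge 0$. If $S(a,b,c,d)$ is a contraction, that is, has operator norm at most $1$, then $S(a,b,c,d)$ is moment infinitely divisible, and so is each of its subshifts, that is, for all integers $p\ge 1$ and $q\ge 0$, the weighted shift with weights $\alpha_{q+pn}$, $n\ge 0$. -/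

import Mathlib

open scoped ENNReal

namespace MomentShift

/-- The complex Hilbert space `ℓ²` of square-summable sequences indexed by `0, 1, 2, …`. -/
abbrev EllTwo : Type := lp (fun _ : ℕ => ℂ) 2

/-- The standard basis vector `e_n` of `ℓ²`. -/
noncomputable def e (n : ℕ) : EllTwo := lp.single 2 n (1 : ℂ)

/-- The sequence `(0, α₀ x₀, α₁ x₁, …)`. -/
noncomputable def shiftFun (α : ℕ → ℝ) (x : ℕ → ℂ) : ℕ → ℂ
  | 0 => 0
  | n + 1 => (α n : ℂ) * x n

theorem shiftFun_sq_le {α : ℕ → ℝ} {C : ℝ} (hC : ∀ n, |α n| ≤ C) (x : ℕ → ℂ) (n : ℕ) :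
    ‖shiftFun α x (n + 1)‖ ^ 2 ≤ C ^ 2 * ‖x n‖ ^ 2 := by
  have h : ‖shiftFun α x (n + 1)‖ = |α n| * ‖x n‖ := by simp [shiftFun]
  rw [h, mul_pow]
  have := hC n
  gcongr

theorem summable_sq (x : EllTwo) : Summable fun n => ‖x n‖ ^ 2 := by
  have h := (lp.memℓp x).summable (by norm_num)
  simpa using h

theorem shiftFun_summable {α : ℕ → ℝ} {C : ℝ} (hC : ∀ n, |α n| ≤ C) (x : EllTwo) :
    Summable fun n => ‖shiftFun α x n‖ ^ 2 := by
  rw [← summable_nat_add_iff 1]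
  exact Summable.of_nonneg_of_le (fun n => by positivity) (shiftFun_sq_le hC x)
    ((summable_sq x).mul_left _)

theorem shiftFun_memℓp {α : ℕ → ℝ} {C : ℝ} (hC : ∀ n, |α n| ≤ C) (x : EllTwo) :
    Memℓp (shiftFun α x) 2 := by
  refine memℓp_gen ?_
  simpa using shiftFun_summable hC x

theorem norm_sq_eq (x : EllTwo) : ‖x‖ ^ 2 = ∑' n, ‖x n‖ ^ 2 := by
  have h := lp.norm_rpow_eq_tsum (p := 2) (by norm_num) x
  simpa using h

theorem exists_bound {α : ℕ → ℝ} (h : BddAbove (Set.range fun n => |α n|)) (n : ℕ) :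
    |α n| ≤ sSup (Set.range fun n => |α n|) :=
  le_csSup h ⟨n, rfl⟩

/-- The unilateral weighted shift `W_α` on `ℓ²` with bounded weight sequence `α`, as a bounded
operator: `W_α (x₀, x₁, …) = (0, α₀ x₀, α₁ x₁, …)`. -/
noncomputable def weightedShift (α : ℕ → ℝ) (h : BddAbove (Set.range fun n => |α n|)) :
    EllTwo →L[ℂ] EllTwo :=
  LinearMap.mkContinuous
    { toFun := fun x => ⟨shiftFun α x, shiftFun_memℓp (exists_bound h) x⟩
      map_add' := fun x y => by
        ext n
        change shiftFun α (x + y : EllTwo) n = shiftFun α x n + shiftFun α y n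
        cases n <;> simp [shiftFun, mul_add]
      map_smul' := fun c x => by
        ext n
        cases n <;> simp [shiftFun, mul_left_comm] }
    (sSup (Set.range fun n => |α n|))
    (fun x => by
      have hC := exists_bound h
      have hC0 := (abs_nonneg _).trans (hC 0)
      refine (pow_le_pow_iff_left₀ (norm_nonneg _) (mul_nonneg hC0 (norm_nonneg x)) two_ne_zero).1 ?_
      rw [mul_pow, norm_sq_eq, norm_sq_eq, ← tsum_mul_left]
      change ∑' n, ‖shiftFun α x n‖ ^ 2 ≤ _
      rw [(shiftFun_summable hC x).tsum_eq_zero_add]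
      have h0 : ‖shiftFun α x 0‖ ^ 2 = 0 := by simp [shiftFun]
      rw [h0, zero_add]
      exact Summable.tsum_le_tsum (shiftFun_sq_le hC x)
        ((summable_nat_add_iff 1).2 (shiftFun_summable hC x)) ((summable_sq x).mul_left _))

/-- The defining property `W_α e_n = α_n e_{n+1}` of the weighted shift. -/
theorem weightedShift_e (α : ℕ → ℝ) (h : BddAbove (Set.range fun n => |α n|)) (n : ℕ) :
    weightedShift α h (e n) = (α n : ℂ) • e (n + 1) := by
  ext m
  change shiftFun α (e n) m = (α n : ℂ) • (e (n + 1)) m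
  cases m with
  | zero => simp [shiftFun, e, lp.single_apply]
  | succ k =>
    by_cases hk : k = n
    · subst hk; simp [shiftFun, e, lp.single_apply]
    · simp [shiftFun, e, lp.single_apply, hk]

/-- A bounded operator `T` on a complex Hilbert space `H` is subnormal if it is unitarily
equivalent to the restriction of a normal operator `N` on a Hilbert space `K` to a closed
invariant subspace: there is an isometric embedding `V : H → K` with `N V = V T` (the range of
`V` is then the closed invariant subspace). -/
def IsSubnormal {H : Type} [NormedAddCommGroup H] [InnerProductSpace ℂ H] [CompleteSpace H]
    (T : H →L[ℂ] H) : Prop :=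
  ∃ (K : Type) (_ : NormedAddCommGroup K) (_ : InnerProductSpace ℂ K) (_ : CompleteSpace K)
    (V : H →ₗᵢ[ℂ] K) (N : K →L[ℂ] K), IsStarNormal N ∧ ∀ x : H, N (V x) = V (T x)

/-- The weights `α` define a (bounded) weighted shift that is subnormal. -/
def IsSubnormalShift (α : ℕ → ℝ) : Prop :=
  ∃ h : BddAbove (Set.range fun n => |α n|), IsSubnormal (weightedShift α h)

/-- The weights `α` define a (bounded) weighted shift of operator norm at most `1`. -/
def IsContractiveShift (α : ℕ → ℝ) : Prop :=
  ∃ h : BddAbove (Set.range fun n => |α n|), ‖weightedShift α h‖ ≤ 1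

/-- The weighted shift with weights `α` is moment infinitely divisible: the weights are positive
and, for every real `t > 0`, the shift with weights `α_n ^ t` is subnormal. -/
def IsMID (α : ℕ → ℝ) : Prop :=
  (∀ n, 0 < α n) ∧ ∀ t : ℝ, 0 < t → IsSubnormalShift fun n => α n ^ t

/-- The weights `√((n + 1) / (n + j))` of the `j`-th Agler shift. -/
noncomputable def aglerWeights (j : ℕ) (n : ℕ) : ℝ :=
  √(((n : ℝ) + 1) / ((n : ℝ) + (j : ℝ)))

/-- The weights `√((a n + b) / (c n + d))` of the shift `S(a, b, c, d)`. -/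
noncomputable def sWeights (a b c d : ℝ) (n : ℕ) : ℝ :=
  √((a * (n : ℝ) + b) / (c * (n : ℝ) + d))

/-- The weights `α_q, α_{q+p}, α_{q+2p}, …` of a subshift of `W_α`, the weights being picked along
an arithmetic progression. -/
def subshiftWeights (α : ℕ → ℝ) (p q : ℕ) (n : ℕ) : ℝ :=
  α (q + p * n)

end MomentShift

namespace MomentShift

/-! Up to the factor `a / c`, the squared weights are `(n + β) / (n + δ)` with `β = b / a < δ = d /
c`. By Berger's criterion, the shift with `t`-th power weights is subnormal once `γ n = ∏_{k<n} ((k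
+ β) / (k + δ)) ^ t` is the moment sequence of a probability measure on `[0, 1]`. Cut `[β, δ]` into
small steps of length `η`. The law Beta(`s`, `tη`) has moments `∏_{k<n} (k + s) / (k + s + tη)`.
Multiplying these over the division points `s` gives the moments of a product of independent
variables, and as `η → 0` they converge to `γ n`. By compactness of the space of probability
measures, the limit is again a moment sequence (`isHausdorffMoment_prod_rpow`). Agler shifts and
subshifts have weights of the same linear fractional form. -/

open MeasureTheory Filter Topology ProbabilityTheory

/-! ### Closure properties of moment sequences -/

/-- `γ` is the moment sequence of a probability measure on `[0, 1]`. -/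
def IsHausdorffMoment (γ : ℕ → ℝ) : Prop :=
  ∃ μ : ProbabilityMeasure unitInterval, ∀ n, γ n = ∫ x : unitInterval, (x : ℝ) ^ n ∂(μ : Measure _)

/-- The continuous function `x ↦ x ^ n` on `[0, 1]`. -/
noncomputable def unitPow (n : ℕ) : C(unitInterval, ℝ) := ⟨fun x => (x : ℝ) ^ n, by fun_prop⟩

theorem integrable_unitPow (μ : Measure unitInterval) [IsFiniteMeasure μ] (n : ℕ) :
    Integrable (fun x : unitInterval => (x : ℝ) ^ n) μ :=
  (BoundedContinuousFunction.mkOfCompact (unitPow n)).integrable μ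

theorem integral_pow_map {Ω : Type*} [MeasurableSpace Ω] {P : Measure Ω} {f : Ω → unitInterval}
    (hf : Measurable f) (n : ℕ) :
    ∫ x : unitInterval, (x : ℝ) ^ n ∂P.map f = ∫ ω, (f ω : ℝ) ^ n ∂P :=
  integral_map hf.aemeasurable (unitPow n).continuous.aestronglyMeasurable

/-- Some subsequence of the measures converges weakly, and each `x ^ n` is a bounded continuous test
function. -/
theorem IsHausdorffMoment.of_tendsto {g : ℕ → ℕ → ℝ} {γ : ℕ → ℝ}
    (hg : ∀ m, IsHausdorffMoment (g m)) (h : ∀ n, Tendsto (fun m => g m n) atTop (𝓝 (γ n))) :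
    IsHausdorffMoment γ := by
  choose μ hμ using hg
  obtain ⟨ν, φ, hφ, hν⟩ := CompactSpace.tendsto_subseq μ
  refine ⟨ν, fun n => ?_⟩
  have h1 := ProbabilityMeasure.tendsto_iff_forall_integral_tendsto.1 hν
    (BoundedContinuousFunction.mkOfCompact (unitPow n))
  refine tendsto_nhds_unique ((h n).comp hφ.tendsto_atTop) (h1.congr fun i => ?_)
  exact (hμ (φ i) n).symm

theorem IsHausdorffMoment.one : IsHausdorffMoment fun _ => 1 :=
  ⟨⟨Measure.dirac 1, inferInstance⟩, fun n => by simp⟩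

/-- The moments of a product of independent variables multiply. -/
theorem IsHausdorffMoment.mul {γ δ : ℕ → ℝ} (hγ : IsHausdorffMoment γ) (hδ : IsHausdorffMoment δ) :
    IsHausdorffMoment fun n => γ n * δ n := by
  obtain ⟨μ, hμ⟩ := hγ
  obtain ⟨ν, hν⟩ := hδ
  have hm : Measurable fun p : unitInterval × unitInterval => p.1 * p.2 := by fun_prop
  refine ⟨⟨((μ : Measure unitInterval).prod (ν : Measure unitInterval)).map fun p => p.1 * p.2,
    Measure.isProbabilityMeasure_map hm.aemeasurable⟩, fun n => ?_⟩
  rw [ProbabilityMeasure.coe_mk, integral_pow_map hm]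
  beta_reduce
  rw [hμ, hν, ← integral_prod_mul]
  simp [mul_pow]

theorem IsHausdorffMoment.prod {ι : Type*} (s : Finset ι) {g : ι → ℕ → ℝ}
    (hg : ∀ i ∈ s, IsHausdorffMoment (g i)) : IsHausdorffMoment fun n => ∏ i ∈ s, g i n := by
  classical
  induction s using Finset.induction_on with
  | empty => simpa using IsHausdorffMoment.one
  | insert i s hi ih =>
    simp_rw [Finset.prod_insert hi]
    exact (hg i (by simp)).mul (ih fun j hj => hg j (by simp [hj]))

theorem IsHausdorffMoment.succ_le {γ : ℕ → ℝ} (h : IsHausdorffMoment γ) (n : ℕ) :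
    γ (n + 1) ≤ γ n := by
  obtain ⟨μ, hμ⟩ := h
  rw [hμ, hμ]
  exact integral_mono (integrable_unitPow _ _) (integrable_unitPow _ _) fun x =>
    pow_le_pow_of_le_one x.2.1 x.2.2 n.le_succ

/-! ### Moments of Beta distributions -/

theorem betaPDFReal_nonneg {b s : ℝ} (hb : 0 < b) (hs : 0 < s) (x : ℝ) : 0 ≤ betaPDFReal b s x := by
  by_cases h : 0 < x ∧ x < 1
  · exact (betaPDFReal_pos h.1 h.2 hb hs).le
  · rw [betaPDFReal, if_neg h]

theorem integral_betaPDFReal {b s : ℝ} (hb : 0 < b) (hs : 0 < s) :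
    ∫ x, betaPDFReal b s x = 1 := by
  rw [integral_eq_lintegral_of_nonneg_ae (ae_of_all _ (betaPDFReal_nonneg hb hs))
    (measurable_betaPDFReal b s).aestronglyMeasurable]
  have := lintegral_betaPDF_eq_one hb hs
  simp only [betaPDF] at this
  simp [this]

theorem beta_add_natCast {b s : ℝ} (hb : 0 < b) (hs : 0 < s) (n : ℕ) :
    beta (b + n) s = (∏ k ∈ Finset.range n, ((k : ℝ) + b) / (k + b + s)) * beta b s := by
  induction n with
  | zero => simp
  | succ n ih =>
    rw [Finset.prod_range_succ, mul_right_comm, ← ih, beta, beta]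
    have h1 : b + ((n + 1 : ℕ) : ℝ) = (b + n) + 1 := by push_cast; ring
    have h2 : b + (n : ℝ) + 1 + s = (b + n + s) + 1 := by ring
    have p1 : 0 < b + (n : ℝ) := by positivity
    have p2 : 0 < b + (n : ℝ) + s := by positivity
    rw [h1, h2, Real.Gamma_add_one p1.ne', Real.Gamma_add_one p2.ne']
    have := (Real.Gamma_pos_of_pos p2).ne'
    have p3 : 0 < (n : ℝ) + b + s := by positivity
    field_simp
    ring

/-- A factor `x ^ n` only shifts the first Beta parameter. Off `(0, 1)` the density vanishes, so
clamping by `Set.projIcc` is harmless. -/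
theorem betaPDFReal_mul_pow {b s : ℝ} (hb : 0 < b) (hs : 0 < s) (n : ℕ) (x : ℝ) :
    betaPDFReal b s x * (Set.projIcc (0 : ℝ) 1 zero_le_one x : ℝ) ^ n =
      (beta (b + n) s / beta b s) * betaPDFReal (b + n) s x := by
  by_cases h : 0 < x ∧ x < 1
  · rw [Set.projIcc_of_mem zero_le_one ⟨h.1.le, h.2.le⟩, betaPDFReal, betaPDFReal, if_pos h,
      if_pos h]
    have h1 := (beta_pos hb hs).ne'
    have h2 := (beta_pos (show 0 < b + (n : ℝ) by positivity) hs).ne'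
    have h3 : b + (n : ℝ) - 1 = (b - 1) + n := by ring
    rw [h3, Real.rpow_add h.1, Real.rpow_natCast]
    field_simp
  · rw [betaPDFReal, betaPDFReal, if_neg h, if_neg h]
    simp

theorem isHausdorffMoment_beta {b s : ℝ} (hb : 0 < b) (hs : 0 < s) :
    IsHausdorffMoment fun n => ∏ k ∈ Finset.range n, ((k : ℝ) + b) / (k + b + s) := by
  have hp := isProbabilityMeasureBeta hb hs
  have hm : Measurable (Set.projIcc (0 : ℝ) 1 zero_le_one) := continuous_projIcc.measurable
  refine ⟨⟨(betaMeasure b s).map (Set.projIcc 0 1 zero_le_one),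
    Measure.isProbabilityMeasure_map hm.aemeasurable⟩, fun n => ?_⟩
  rw [ProbabilityMeasure.coe_mk, integral_pow_map hm, betaMeasure,
    integral_withDensity_eq_integral_toReal_smul (by unfold betaPDF; fun_prop)
      (ae_of_all _ fun x => by simp [betaPDF])]
  have : ∀ x, (betaPDF b s x).toReal • (Set.projIcc (0 : ℝ) 1 zero_le_one x : ℝ) ^ n =
      (beta (b + n) s / beta b s) * betaPDFReal (b + n) s x := fun x => by
    rw [betaPDF, ENNReal.toReal_ofReal (betaPDFReal_nonneg hb hs x), smul_eq_mul,
      betaPDFReal_mul_pow hb hs]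
  simp_rw [this]
  rw [integral_const_mul, integral_betaPDFReal (by positivity) hs, beta_add_natCast hb hs, mul_one,
    mul_div_cancel_right₀ _ (beta_pos hb hs).ne']

/-! ### Real powers as limits of Beta products -/

theorem abs_log_one_add_sub_le {x : ℝ} (hx : 0 ≤ x) : |Real.log (1 + x) - x| ≤ x ^ 2 := by
  have h1 := Real.one_sub_inv_le_log_of_pos (show 0 < 1 + x by linarith)
  have h2 := Real.log_le_sub_one_of_pos (show 0 < 1 + x by linarith)
  have h3 : (1 + x)⁻¹ ≤ 1 - x + x ^ 2 := by
    rw [inv_le_iff_one_le_mul₀ (by linarith)]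
    nlinarith [pow_nonneg hx 3]
  rw [abs_le]
  constructor <;> nlinarith

/-- After taking logarithms, the case `t = 1` telescopes exactly. For other `t`, each of the `m + 1`
terms differs from `t` times its telescoping counterpart by `O(1 / (m + 1) ^ 2)`. -/
theorem tendsto_prod_div_rpow {b d t : ℝ} (hb : 0 < b) (hbd : b ≤ d) (ht : 0 < t) :
    Tendsto (fun m : ℕ => ∏ i ∈ Finset.range (m + 1),
      (b + i * ((d - b) / (m + 1))) / (b + i * ((d - b) / (m + 1)) + t * ((d - b) / (m + 1))))
      atTop (𝓝 ((b / d) ^ t)) := by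
  have hd : 0 < d := hb.trans_le hbd
  set D := d - b with hD
  have hD0 : 0 ≤ D := sub_nonneg.2 hbd
  have hpos : ∀ (m i : ℕ), 0 < b + i * (D / ((m : ℝ) + 1)) := fun m i => by positivity
  suffices H : Tendsto (fun m : ℕ => ∑ i ∈ Finset.range (m + 1),
      (Real.log (1 + t * (D / (m + 1)) / (b + i * (D / (m + 1))))))
      atTop (𝓝 (t * (Real.log d - Real.log b))) by
    have h1 := (Real.continuous_exp.tendsto _).comp H.neg
    have h2 : Real.exp (-(t * (Real.log d - Real.log b))) = (b / d) ^ t := by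
      rw [Real.rpow_def_of_pos (by positivity), Real.log_div hb.ne' hd.ne']
      ring_nf
    rw [h2] at h1
    refine h1.congr fun m => ?_
    simp only [Function.comp, Real.exp_neg, Real.exp_sum]
    rw [← Finset.prod_inv_distrib]
    refine Finset.prod_congr rfl fun i _ => ?_
    have := hpos m i
    rw [Real.exp_log (by positivity), one_add_div this.ne', inv_div]
  have htel : ∀ m : ℕ, ∑ i ∈ Finset.range (m + 1),
      Real.log (1 + (D / (m + 1)) / (b + i * (D / (m + 1)))) = Real.log d - Real.log b := by
    intro m
    have : ∀ i ∈ Finset.range (m + 1), Real.log (1 + (D / (m + 1)) / (b + i * (D / (m + 1)))) =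
        Real.log (b + (i + 1 : ℕ) * (D / (m + 1))) - Real.log (b + i * (D / (m + 1))) := by
      intro i _
      rw [← Real.log_div (hpos m (i + 1)).ne' (hpos m i).ne', one_add_div (hpos m i).ne']
      push_cast
      ring_nf
    rw [Finset.sum_congr rfl this,
      Finset.sum_range_sub fun i : ℕ => Real.log (b + i * (D / ((m : ℝ) + 1)))]
    have h3 : b + ((m + 1 : ℕ) : ℝ) * (D / ((m : ℝ) + 1)) = d := by
      push_cast
      field_simp
      simp [hD]
    rw [h3]
    simp
  rw [tendsto_iff_norm_sub_tendsto_zero]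
  have hlim : Tendsto (fun m : ℕ => ((t ^ 2 + t) * (D / b) ^ 2) * (1 / ((m : ℝ) + 1))) atTop (𝓝 0) := by
    simpa using tendsto_one_div_add_atTop_nhds_zero_nat.const_mul ((t ^ 2 + t) * (D / b) ^ 2)
  refine squeeze_zero (fun _ => norm_nonneg _) (fun m => ?_) hlim
  rw [← htel m, Finset.mul_sum, ← Finset.sum_sub_distrib]
  refine (norm_sum_le _ _).trans ?_
  have hterm : ∀ i ∈ Finset.range (m + 1),
      ‖Real.log (1 + t * (D / (m + 1)) / (b + i * (D / (m + 1)))) -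
        t * Real.log (1 + (D / (m + 1)) / (b + i * (D / (m + 1))))‖ ≤
      (t ^ 2 + t) * (D / b) ^ 2 * (1 / ((m : ℝ) + 1)) ^ 2 := by
    intro i _
    set x := (D / ((m : ℝ) + 1)) / (b + i * (D / (m + 1))) with hx
    have hx0 : 0 ≤ x := by have := hpos m i; positivity
    have hx1 : x ≤ (D / b) * (1 / ((m : ℝ) + 1)) := by
      have : (D / b) * (1 / ((m : ℝ) + 1)) = (D / ((m : ℝ) + 1)) / b := by ring
      rw [this, hx]
      have h4 : 0 ≤ i * (D / ((m : ℝ) + 1)) := by positivity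
      gcongr
      linarith
    have e1 := abs_log_one_add_sub_le (mul_nonneg ht.le hx0)
    have e2 := abs_log_one_add_sub_le hx0
    rw [mul_div_assoc, ← hx, Real.norm_eq_abs]
    calc |Real.log (1 + t * x) - t * Real.log (1 + x)|
        = |(Real.log (1 + t * x) - t * x) - t * (Real.log (1 + x) - x)| := by ring_nf
      _ ≤ |Real.log (1 + t * x) - t * x| + |t * (Real.log (1 + x) - x)| := abs_sub _ _
      _ ≤ (t * x) ^ 2 + t * x ^ 2 := by
        rw [abs_mul, abs_of_pos ht]
        gcongr
      _ = (t ^ 2 + t) * x ^ 2 := by ring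
      _ ≤ (t ^ 2 + t) * ((D / b) * (1 / ((m : ℝ) + 1))) ^ 2 := by gcongr
      _ = _ := by ring
  refine (Finset.sum_le_sum hterm).trans (le_of_eq ?_)
  rw [Finset.sum_const, Finset.card_range, nsmul_eq_mul]
  push_cast
  field_simp

theorem isHausdorffMoment_prod_rpow {b d t : ℝ} (hb : 0 < b) (hbd : b ≤ d) (ht : 0 < t) :
    IsHausdorffMoment fun n => ∏ k ∈ Finset.range n, (((k : ℝ) + b) / (k + d)) ^ t := by
  rcases hbd.eq_or_lt with rfl | hlt
  -- Treated apart, since a Beta law needs a positive second parameter.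
  · have : ∀ k : ℕ, ((k : ℝ) + b) / (k + b) = 1 := fun k => div_self (by positivity)
    simpa [this] using IsHausdorffMoment.one
  have hD : 0 < d - b := sub_pos.2 hlt
  refine IsHausdorffMoment.of_tendsto
    (g := fun m n => ∏ i ∈ Finset.range (m + 1), ∏ k ∈ Finset.range n,
      ((k : ℝ) + (b + i * ((d - b) / (m + 1)))) /
        (k + (b + i * ((d - b) / (m + 1))) + t * ((d - b) / (m + 1)))) (fun m => ?_) fun n => ?_
  · exact IsHausdorffMoment.prod _ fun i _ =>
      isHausdorffMoment_beta (by positivity) (by positivity)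
  -- For fixed `k`, replacing `b, d` by `k + b, k + d` leaves the step length unchanged.
  · refine Tendsto.congr (fun m => Finset.prod_comm) (tendsto_finsetProd _ fun k _ => ?_)
    have := tendsto_prod_div_rpow (b := k + b) (d := k + d) (t := t) (by positivity)
      (by linarith) ht
    simpa [add_assoc] using this

/-! ### Normal multiplication operators on `L²` -/

section Multiplication

variable {X : Type} [TopologicalSpace X] [CompactSpace X] [MeasurableSpace X] [BorelSpace X]
  (ν : Measure X) [IsFiniteMeasure ν]

/-- Multiplication by a continuous function, as an operator on `L²`. -/
noncomputable def mulOp (φ : C(X, ℂ)) : Lp ℂ 2 ν →L[ℂ] Lp ℂ 2 ν :=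
  LinearMap.mkContinuous
    { toFun := fun f => (ContinuousMap.toLp ⊤ ν ℂ φ : Lp ℂ ⊤ ν) • f
      map_add' := Lp.add_smul _
      map_smul' := fun c f => (Lp.smul_comm c _ f).symm }
    ‖(ContinuousMap.toLp ⊤ ν ℂ φ : Lp ℂ ⊤ ν)‖ (fun f => Lp.norm_smul_le _ f)

theorem coeFn_mulOp (φ : C(X, ℂ)) (f : Lp ℂ 2 ν) : mulOp ν φ f =ᵐ[ν] fun x => φ x * f x := by
  have h : (mulOp ν φ f : X → ℂ) =ᵐ[ν]
      ((ContinuousMap.toLp ⊤ ν ℂ φ : Lp ℂ ⊤ ν) : X → ℂ) • (f : X → ℂ) := Lp.coeFn_lpSMul _ f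
  filter_upwards [h, ContinuousMap.coeFn_toLp (p := ⊤) (𝕜 := ℂ) ν φ] with x h1 h2
  rw [h1, Pi.smul_apply', h2, smul_eq_mul]

theorem mulOp_toLp (φ f : C(X, ℂ)) :
    mulOp ν φ (ContinuousMap.toLp 2 ν ℂ f) = ContinuousMap.toLp 2 ν ℂ (φ * f) := by
  refine Lp.ext ?_
  filter_upwards [coeFn_mulOp ν φ (ContinuousMap.toLp 2 ν ℂ f),
    ContinuousMap.coeFn_toLp (p := 2) (𝕜 := ℂ) ν f,
    ContinuousMap.coeFn_toLp (p := 2) (𝕜 := ℂ) ν (φ * f)] with x h1 h2 h3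
  rw [h1, h2, h3, ContinuousMap.mul_apply]

theorem mulOp_mul (φ ψ : C(X, ℂ)) : mulOp ν (φ * ψ) = mulOp ν φ * mulOp ν ψ := by
  ext1 f
  refine Lp.ext ?_
  change mulOp ν (φ * ψ) f =ᵐ[ν] mulOp ν φ (mulOp ν ψ f)
  filter_upwards [coeFn_mulOp ν (φ * ψ) f, coeFn_mulOp ν φ (mulOp ν ψ f),
    coeFn_mulOp ν ψ f] with x h1 h2 h3
  rw [h1, h2, h3, ContinuousMap.mul_apply, mul_assoc]

theorem star_mulOp (φ : C(X, ℂ)) : star (mulOp ν φ) = mulOp ν (star φ) := by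
  rw [ContinuousLinearMap.star_eq_adjoint, eq_comm, ContinuousLinearMap.eq_adjoint_iff]
  intro f g
  rw [L2.inner_def, L2.inner_def]
  refine integral_congr_ae ?_
  filter_upwards [coeFn_mulOp ν (star φ) f, coeFn_mulOp ν φ g] with x h1 h2
  rw [h1, h2]
  simp only [RCLike.inner_apply, map_mul, ContinuousMap.star_apply, RCLike.star_def,
    RCLike.conj_conj]
  ring

theorem isStarNormal_mulOp (φ : C(X, ℂ)) : IsStarNormal (mulOp ν φ) := by
  rw [isStarNormal_iff, star_mulOp, Commute, SemiconjBy, ← mulOp_mul, ← mulOp_mul, mul_comm]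

end Multiplication

/-! ### Subnormality from moments -/

/-- A weighted shift acting like a normal operator on an orthonormal sequence is subnormal. -/
theorem isSubnormal_weightedShift_of_orthonormal {α : ℕ → ℝ}
    (h : BddAbove (Set.range fun n => |α n|)) {K : Type} [NormedAddCommGroup K]
    [InnerProductSpace ℂ K] [CompleteSpace K] {v : ℕ → K} (hv : Orthonormal ℂ v)
    {N : K →L[ℂ] K} (hN : IsStarNormal N) (hNv : ∀ n, N (v n) = (α n : ℂ) • v (n + 1)) :
    IsSubnormal (weightedShift α h) := by
  have hVe : ∀ n, hv.orthogonalFamily.linearIsometry (e n) = v n := fun n => by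
    rw [e, OrthogonalFamily.linearIsometry_apply_single]
    simp
  refine ⟨K, _, _, ‹_›, hv.orthogonalFamily.linearIsometry, N, hN, ?_⟩
  suffices H : N ∘L hv.orthogonalFamily.linearIsometry.toContinuousLinearMap =
      hv.orthogonalFamily.linearIsometry.toContinuousLinearMap ∘L weightedShift α h from
    fun x => DFunLike.congr_fun H x
  -- Bounded operators on `ℓ²` are determined by their values on the basis.
  refine lp.ext_continuousLinearMap (by simp) fun n => ?_
  ext
  change N (hv.orthogonalFamily.linearIsometry (e n)) =
    hv.orthogonalFamily.linearIsometry (weightedShift α h (e n))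
  rw [weightedShift_e, map_smul, hVe, hVe, hNv]

theorem integral_fourier_mul_conj (m n : ℤ) :
    ∫ z : UnitAddCircle, fourier n z * (starRingEnd ℂ) (fourier m z) ∂AddCircle.haarAddCircle =
      if m = n then 1 else 0 := by
  have h := congrFun (fourierCoeff_fourier (T := 1) n) m
  simp only [fourierCoeff, fourier_neg, smul_eq_mul, Pi.single_apply] at h
  rw [← h]
  exact integral_congr_ae (Filter.Eventually.of_forall fun z => mul_comm _ _)

/-- The continuous function `(x, z) ↦ c √x ^ n z ^ n` on `[0, 1] × 𝕋`. -/
noncomputable def polarMonomial (c : ℝ) (n : ℕ) : C(unitInterval × UnitAddCircle, ℂ) :=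
  ⟨fun p => (c * √(p.1 : ℝ) ^ n : ℝ) * fourier (n : ℤ) p.2, by
    refine Continuous.mul (by fun_prop) ((fourier (n : ℤ)).continuous.comp continuous_snd)⟩

theorem polarMonomial_mul (c d : ℝ) (m n : ℕ) :
    polarMonomial c m * polarMonomial d n = polarMonomial (c * d) (m + n) := by
  ext p
  simp only [polarMonomial, ContinuousMap.mul_apply, ContinuousMap.coe_mk, Nat.cast_add,
    fourier_add]
  push_cast
  ring

theorem inner_polarMonomial (μ : Measure unitInterval) [IsProbabilityMeasure μ] (c d : ℝ)
    (m n : ℕ) :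
    inner ℂ (ContinuousMap.toLp 2 (μ.prod AddCircle.haarAddCircle) ℂ (polarMonomial c m))
      (ContinuousMap.toLp 2 (μ.prod AddCircle.haarAddCircle) ℂ (polarMonomial d n)) =
      if m = n then ((c * d * ∫ x : unitInterval, (x : ℝ) ^ n ∂μ : ℝ) : ℂ) else 0 := by
  rw [ContinuousMap.inner_toLp]
  have : ∀ p : unitInterval × UnitAddCircle,
      polarMonomial d n p * (starRingEnd ℂ) (polarMonomial c m p) =
      ((c * d * √(p.1 : ℝ) ^ (m + n) : ℝ) : ℂ) *
        (fourier (n : ℤ) p.2 * (starRingEnd ℂ) (fourier (m : ℤ) p.2)) := fun p => by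
    simp only [polarMonomial, ContinuousMap.coe_mk, map_mul, Complex.conj_ofReal]
    push_cast
    ring
  simp_rw [this]
  rw [integral_prod_mul (fun x : unitInterval => ((c * d * √(x : ℝ) ^ (m + n) : ℝ) : ℂ))
    (fun z : UnitAddCircle => fourier (n : ℤ) z * (starRingEnd ℂ) (fourier (m : ℤ) z)),
    integral_fourier_mul_conj]
  split_ifs with h1 h2 h2
  · subst h2
    have h3 : ∀ x : unitInterval, √(x : ℝ) ^ (m + m) = (x : ℝ) ^ m := fun x => by
      rw [← two_mul, pow_mul, Real.sq_sqrt x.2.1]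
    simp_rw [h3]
    rw [mul_one, integral_complex_ofReal, integral_const_mul]
  · exact absurd (by exact_mod_cast h1) h2
  · exact absurd (by exact_mod_cast h2) h1
  · simp

/-- The easy half of Berger's theorem. -/
theorem IsHausdorffMoment.isSubnormalShift {γ α : ℕ → ℝ} (hγ : IsHausdorffMoment γ)
    (hpos : ∀ n, 0 < γ n) (hα : ∀ n, 0 ≤ α n) {R : ℝ} (hR : 0 ≤ R)
    (h : ∀ n, α n ^ 2 * γ n = R * γ (n + 1)) : IsSubnormalShift α := by
  have hle : ∀ n, |α n| ≤ √R := fun n => by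
    rw [abs_of_nonneg (hα n)]
    refine Real.le_sqrt_of_sq_le (le_of_mul_le_mul_right ?_ (hpos n))
    rw [h]
    exact mul_le_mul_of_nonneg_left (hγ.succ_le n) hR
  refine ⟨⟨√R, by rintro _ ⟨n, rfl⟩; exact hle n⟩, ?_⟩
  obtain ⟨μ, hμ⟩ := hγ
  have hs : ∀ n, α n * √(γ n) = √R * √(γ (n + 1)) := fun n => by
    rw [← Real.sqrt_mul hR, ← h, Real.sqrt_mul (sq_nonneg _), Real.sqrt_sq (hα n)]
  have hsp : ∀ n, √(γ n) ≠ 0 := fun n => (Real.sqrt_pos.2 (hpos n)).ne'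
  refine isSubnormal_weightedShift_of_orthonormal _
    -- With `μ` the law of `x` and `z` uniform on the circle, the normalised `(√x z) ^ n` are
    -- orthonormal: the angle separates degrees and the radius yields `γ n`. Multiplication by `√R
    -- √x z` shifts them.
    (v := fun n => ContinuousMap.toLp 2 ((μ : Measure unitInterval).prod AddCircle.haarAddCircle) ℂ
      (polarMonomial (√(γ n))⁻¹ n)) ?_
    (isStarNormal_mulOp _ (polarMonomial (√R) 1)) fun n => ?_
  · rw [orthonormal_iff_ite]
    intro m n
    rw [inner_polarMonomial, ← hμ]
    split_ifs with hmn
    · subst hmn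
      rw [← mul_inv, Real.mul_self_sqrt (hpos m).le, inv_mul_cancel₀ (hpos m).ne',
        Complex.ofReal_one]
    · rfl
  · rw [mulOp_toLp, polarMonomial_mul, ← map_smul]
    congr 1
    have h1 : √R * (√(γ n))⁻¹ = α n * (√(γ (n + 1)))⁻¹ := by
      have := hs n
      have h2 := hsp n
      have h3 := hsp (n + 1)
      field_simp
      linarith
    rw [h1, add_comm 1 n]
    ext p
    simp only [polarMonomial, ContinuousMap.smul_apply, ContinuousMap.coe_mk, smul_eq_mul]
    push_cast
    ring

/-! ### The linear fractional weights -/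

theorem isMID_sWeights {a b c d : ℝ} (ha : 0 < a) (hb : 0 < b) (hc : 0 < c) (hd : 0 < d)
    (h : b * c ≤ a * d) : IsMID (sWeights a b c d) := by
  have hpos : ∀ n : ℕ, 0 < (a * (n : ℝ) + b) / (c * n + d) := fun n => by positivity
  have hpos' : ∀ n : ℕ, 0 < ((n : ℝ) + b / a) / (n + d / c) := fun n => by positivity
  refine ⟨fun n => Real.sqrt_pos.2 (hpos n), fun t ht => ?_⟩
  have hbd : b / a ≤ d / c := by
    rw [div_le_div_iff₀ ha hc]
    linarith
  refine (isHausdorffMoment_prod_rpow (by positivity) hbd ht).isSubnormalShift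
    (R := (a / c) ^ t) (fun n => Finset.prod_pos fun k _ => Real.rpow_pos_of_pos (hpos' k) t)
    (fun n => Real.rpow_nonneg (Real.sqrt_nonneg _) t) (by positivity) fun n => ?_
  have h1 : (a * (n : ℝ) + b) / (c * n + d) = (a / c) * (((n : ℝ) + b / a) / (n + d / c)) := by
    field_simp
  rw [Finset.prod_range_succ, sWeights, ← Real.rpow_natCast, ← Real.rpow_mul (Real.sqrt_nonneg _),
    mul_comm t, Real.rpow_mul (Real.sqrt_nonneg _), Real.rpow_natCast, Real.sq_sqrt (hpos n).le, h1,
    Real.mul_rpow (by positivity) (hpos' n).le]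
  ring

theorem aglerWeights_eq (j : ℕ) : aglerWeights j = sWeights 1 1 1 j := by
  funext n
  simp [aglerWeights, sWeights]

theorem subshiftWeights_sWeights (a b c d : ℝ) (p q : ℕ) :
    subshiftWeights (sWeights a b c d) p q =
      sWeights (a * p) (a * q + b) (c * p) (c * q + d) := by
  funext n
  simp only [subshiftWeights, sWeights]
  push_cast
  ring_nf

end MomentShift

theorem corollary3p2 :
    (∀ j : ℕ, 1 ≤ j → MomentShift.IsMID (MomentShift.aglerWeights j)) ∧
    (∀ a b c d : ℝ, 0 < a → 0 < b → 0 < c → 0 < d → b * c < a * d →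
      MomentShift.IsContractiveShift (MomentShift.sWeights a b c d) →
        MomentShift.IsMID (MomentShift.sWeights a b c d) ∧
        ∀ p q : ℕ, 1 ≤ p →
          MomentShift.IsMID
            (MomentShift.subshiftWeights (MomentShift.sWeights a b c d) p q)) := by
  refine ⟨fun j hj => ?_, fun a b c d ha hb hc hd h _ => ⟨?_, fun p q hp => ?_⟩⟩
  · have hj' : (1 : ℝ) ≤ j := by exact_mod_cast hj
    rw [MomentShift.aglerWeights_eq]
    exact MomentShift.isMID_sWeights one_pos one_pos one_pos (by linarith) (by linarith)
  · exact MomentShift.isMID_sWeights ha hb hc hd h.le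
  · have hp' : (0 : ℝ) < p := by exact_mod_cast hp
    rw [MomentShift.subshiftWeights_sWeights]
    refine MomentShift.isMID_sWeights (by positivity) (by positivity) (by positivity)
      (by positivity) ?_
    -- The new determinant is `p (ad - bc)`.
    nlinarith [mul_pos hp' (sub_pos.2 h)]
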